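/- All digraphs here are finite, without loops and without parallel arcs (a pair of opposite arcs is allowed). The complement $D^c$ of a digraph $D$ has the same vertex set, and for distinct vertices $u,v$ the arc $uv$ belongs to $D^c$ if and only if it does not belong to $D$. For $S\subseteq V(D)$ with $|S|\ge 2$ and $r\in S$, an $(S,r)$-path is a directed path $P$ (without repeated vertices) in $D$ that starts at $r$ and satisfies $S\subseteq V(P)$. Let $\lambda^p_{S,r}(D)$ be the maximum number of pairwise arc-disjoint $(S,r)$-paths in $D$, and for $2\le k\le |V(D)|$ let $$\lambda^p_k(D)=\min\{\lambda^p_{S,r}(D)\mid S\subseteq V(D),\ |S|=k,\ r\in S\}.$$ Theorem. Let $n\ge 7$ and $2\le k\le n$ be integers. For every digraph $D$ of order $n$: (i) $0\le \lambda^p_k(D)+\lambda^p_k(D^c)\le n-1$; (ii) $0\le \lambda^p_k(D)\,\lambda^p_k(D^c)\le \left\lfloor\left(\frac{n-1}{2}\right)^2\right\rfloor$. Moreover, all four bounds are sharp: for every $n\ge 7$ and every $2\le k\le n$, and for each of the four bounds, there is a digraph $D$ of order $n$ for which that bound holds with equality. -/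

import Mathlib

namespace Digraph

variable {V : Type*}

/-- A digraph is *loopless* if it has no arc from a vertex to itself. Since `Digraph V` has at most
one arc from `u` to `v`, loopless digraphs are the simple digraphs (opposite arcs are allowed). -/
def Loopless (D : Digraph V) : Prop :=
  ∀ v, ¬ D.Adj v v

/-- The (loopless) complement of a digraph: for distinct `u`, `v` there is an arc from `u` to `v`
exactly when there is none in `D`. -/
def looplessCompl (D : Digraph V) : Digraph V where
  Adj u v := u ≠ v ∧ ¬ D.Adj u v

/-- The set of arcs traversed by a sequence of vertices: its pairs of consecutive vertices. -/
def pathArcs (p : List V) : Set (V × V) :=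
  {a | a ∈ p.zip p.tail}

/-- `p` is the vertex sequence of a directed path of `D` (no vertex is repeated, consecutive
vertices are joined by arcs) that starts at `r` and visits every vertex of `S`. -/
structure IsSteinerPath (D : Digraph V) (S : Finset V) (r : V) (p : List V) : Prop where
  head_eq : p.head? = some r
  nodup : p.Nodup
  isChain : p.IsChain D.Adj
  subset : ∀ v ∈ S, v ∈ p

/-- The maximum number of pairwise arc-disjoint `(S, r)`-paths in `D`. -/
noncomputable def arcPacking (D : Digraph V) (S : Finset V) (r : V) : ℕ :=
  sSup {m | ∃ P : Finset (List V), P.card = m ∧ (∀ p ∈ P, D.IsSteinerPath S r p) ∧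
    (P : Set (List V)).PairwiseDisjoint pathArcs}

/-- The directed path `k`-arc-connectivity of `D`: the minimum of `arcPacking D S r` over all
`k`-element sets `S` of vertices and all `r ∈ S`. -/
noncomputable def pathArcConnectivity (D : Digraph V) (k : ℕ) : ℕ :=
  sInf {m | ∃ S : Finset V, S.card = k ∧ ∃ r ∈ S, m = D.arcPacking S r}

end Digraph

/-! Upper bounds: the paths of a packing leave `r` by different arcs, so the connectivity is at most
every out-degree. The out-degrees of `r` in the digraph and its complement add up to `n - 1`, and
AM-GM turns the sum bound into the product bound. For the zero bounds, an out-star has a vertex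
without out-arcs, and so does its complement.

The maxima rest on a Hamilton decomposition of the complete digraph into `n - 1` cycles
(`exists_isHamiltonDecomposition`). Cut at `r`, each cycle is a path that serves every `S`. Half of
the cycles and the remaining ones thus give complementary digraphs whose lower bounds add up to `n -
1`, so both are exact.

For `n = 2t + 1` the cycles are translates of a zigzag in `ZMod (2 * t)` with a point `∞`. For `n =
2t + 2`, `exists_option` inserts a vertex into one arc of each cycle; the removed arcs are chosen to
form a Hamilton path, which the new vertex closes to the missing cycle. Such a path is written down
explicitly for each parity of `t`. -/

namespace Digraph

/-! ### Out-degree bounds and the zero example -/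

variable {V : Type*}

/-- A Steiner path of a set with at least two vertices starts with an arc leaving the root. -/
theorem IsSteinerPath.exists_eq_cons_cons {D : Digraph V} {S : Finset V} {r : V} {p : List V}
    (h : D.IsSteinerPath S r p) (hS : 2 ≤ S.card) :
    ∃ v l, p = r :: v :: l ∧ D.Adj r v := by
  classical
  have hlen : 2 ≤ p.length := by
    refine hS.trans ((Finset.card_le_card (t := p.toFinset) fun v hv => ?_).trans
      p.toFinset_card_le)
    simpa using h.subset v hv
  have h1 := h.head_eq
  have h2 := h.isChain
  match p, hlen with
  | a :: b :: l, _ =>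
    obtain rfl : a = r := by simpa using h1
    exact ⟨b, l, rfl, (List.isChain_cons_cons.mp h2).1⟩

/-- Arc-disjoint paths have distinct first arcs, all leaving `r`. -/
theorem card_le_ncard_adj [Finite V] {D : Digraph V} {S : Finset V} {r : V} (hS : 2 ≤ S.card)
    {P : Finset (List V)} (hP : ∀ p ∈ P, D.IsSteinerPath S r p)
    (hd : (P : Set (List V)).PairwiseDisjoint pathArcs) :
    P.card ≤ {v | D.Adj r v}.ncard := by
  have key : ∀ p ∈ P, ∃ v, D.Adj r v ∧ (r, v) ∈ pathArcs p := by
    intro p hp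
    obtain ⟨v, l, rfl, hv⟩ := (hP p hp).exists_eq_cons_cons hS
    exact ⟨v, hv, by simp [pathArcs]⟩
  have : Nonempty V := ⟨r⟩
  choose! f hf using key
  rw [← Set.ncard_coe_finset]
  refine Set.ncard_le_ncard_of_injOn f (fun p hp => (hf p hp).1) ?_ (Set.toFinite _)
  intro p hp q hq hpq
  by_contra hne
  refine Set.disjoint_left.mp (hd hp hq hne) (hf p hp).2 ?_
  rw [hpq]
  exact (hf q hq).2

theorem arcPacking_le_ncard_adj [Finite V] (D : Digraph V) {S : Finset V} (r : V)
    (hS : 2 ≤ S.card) : D.arcPacking S r ≤ {v | D.Adj r v}.ncard := by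
  refine csSup_le ⟨0, ∅, by simp⟩ ?_
  rintro m ⟨P, rfl, hP, hd⟩
  exact card_le_ncard_adj hS hP hd

theorem card_le_arcPacking [Finite V] {D : Digraph V} {S : Finset V} {r : V} (hS : 2 ≤ S.card)
    {P : Finset (List V)} (hP : ∀ p ∈ P, D.IsSteinerPath S r p)
    (hd : (P : Set (List V)).PairwiseDisjoint pathArcs) : P.card ≤ D.arcPacking S r := by
  -- The out-degree bounds the set, without which `sSup` would be the default value 0.
  refine le_csSup ⟨{v | D.Adj r v}.ncard, ?_⟩ ⟨P, rfl, hP, hd⟩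
  rintro m ⟨Q, rfl, hQ, hQd⟩
  exact card_le_ncard_adj hS hQ hQd

/-- The path arc-connectivity is at most the minimum out-degree. -/
theorem pathArcConnectivity_le_ncard_adj [Fintype V] (D : Digraph V) {k : ℕ} (hk : 2 ≤ k)
    (hkn : k ≤ Fintype.card V) (r : V) : D.pathArcConnectivity k ≤ {v | D.Adj r v}.ncard := by
  obtain ⟨S, hrS, -, hS⟩ := Finset.exists_subsuperset_card_eq (Finset.subset_univ {r})
    (by simpa using by omega) hkn
  refine le_trans (Nat.sInf_le ⟨S, hS, r, by simpa using hrS, rfl⟩) ?_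
  exact D.arcPacking_le_ncard_adj r (hS ▸ hk)

theorem le_pathArcConnectivity [Fintype V] {D : Digraph V} {k m : ℕ} (hk : 2 ≤ k)
    (hkn : k ≤ Fintype.card V) (h : ∀ S : Finset V, S.card = k → ∀ r ∈ S, m ≤ D.arcPacking S r) :
    m ≤ D.pathArcConnectivity k := by
  -- The infimum of an empty set would be 0, so an admissible pair `(S, r)` has to be exhibited.
  refine le_csInf ?_ ?_
  · obtain ⟨S, -, hS⟩ := Finset.exists_subset_card_eq (s := (Finset.univ : Finset V)) hkn
    obtain ⟨r, hr⟩ : S.Nonempty := Finset.card_pos.mp (by omega)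
    exact ⟨_, S, hS, r, hr, rfl⟩
  · rintro _ ⟨S, hS, r, hr, rfl⟩
    exact h S hS r hr

theorem ncard_adj_add_ncard_adj_looplessCompl [Fintype V] {D : Digraph V} (hD : D.Loopless)
    (r : V) :
    {v | D.Adj r v}.ncard + {v | D.looplessCompl.Adj r v}.ncard = Fintype.card V - 1 := by
  classical
  rw [← Set.ncard_union_eq]
  · have : {v | D.Adj r v} ∪ {v | D.looplessCompl.Adj r v} = {r}ᶜ := by
      ext v
      have := hD r
      simp only [looplessCompl, Set.mem_union, Set.mem_ofPred_eq, Set.mem_compl_iff,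
        Set.mem_singleton_iff]
      grind
    rw [this, Set.ncard_compl, Set.ncard_singleton, Nat.card_eq_fintype_card]
  · rw [Set.disjoint_left]
    exact fun v hv hv' => hv'.2 hv

theorem pathArcConnectivity_add_looplessCompl_le [Fintype V] {D : Digraph V} (hD : D.Loopless)
    {k : ℕ} (hk : 2 ≤ k) (hkn : k ≤ Fintype.card V) :
    D.pathArcConnectivity k + D.looplessCompl.pathArcConnectivity k ≤ Fintype.card V - 1 := by
  obtain ⟨r⟩ : Nonempty V := Fintype.card_pos_iff.mp (by omega)
  rw [← ncard_adj_add_ncard_adj_looplessCompl hD r]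
  exact add_le_add (D.pathArcConnectivity_le_ncard_adj hk hkn r)
    (D.looplessCompl.pathArcConnectivity_le_ncard_adj hk hkn r)

theorem exists_pathArcConnectivity_add_looplessCompl_eq_zero [Fintype V] {k : ℕ} (hk : 2 ≤ k)
    (hkn : k ≤ Fintype.card V) :
    ∃ D : Digraph V, D.Loopless ∧
      D.pathArcConnectivity k + D.looplessCompl.pathArcConnectivity k = 0 := by
  obtain ⟨x, y, hxy⟩ := Fintype.exists_pair_of_one_lt_card (α := V) (by omega)
  -- The out-star at `y`: `x` has no out-arc in it, and `y` has none in the complement.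
  let D : Digraph V := ⟨fun u v => u = y ∧ u ≠ v⟩
  refine ⟨D, fun v h => h.2 rfl, ?_⟩
  have h1 := D.pathArcConnectivity_le_ncard_adj hk hkn x
  have h2 := D.looplessCompl.pathArcConnectivity_le_ncard_adj hk hkn y
  have e1 : {v | D.Adj x v} = ∅ := Set.eq_empty_of_forall_notMem fun v h => hxy h.1
  have e2 : {v | D.looplessCompl.Adj y v} = ∅ :=
    Set.eq_empty_of_forall_notMem fun v h => h.2 ⟨rfl, h.1⟩
  simp only [e1, e2, Set.ncard_empty] at h1 h2
  omega

end Digraph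

/-! ### Hamilton decompositions -/

/-- A family of permutations of `V` that are cycles through all of `V`, such that every arc of the
complete digraph on `V` is traversed by one of them. -/
structure IsHamiltonDecomposition {ι V : Type*} (σ : ι → Equiv.Perm V) : Prop where
  sameCycle : ∀ i u v, (σ i).SameCycle u v
  exists_apply_eq : ∀ u v, u ≠ v → ∃ i, σ i u = v

namespace IsHamiltonDecomposition

variable {ι V : Type*} {σ : ι → Equiv.Perm V}

theorem apply_ne [Nontrivial V] (h : IsHamiltonDecomposition σ) (i : ι) (u : V) : σ i u ≠ u := by
  intro hu
  obtain ⟨v, hv⟩ := exists_ne u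
  obtain ⟨m, hm⟩ := h.sameCycle i u v
  exact hv (by rw [← hm, Equiv.Perm.zpow_apply_eq_self_of_apply_eq_self hu])

/-- Covering forces arc-disjointness by counting: `card V - 1` cycles leave `u`, and together they
reach all `card V - 1` other vertices. -/
theorem apply_injective [Fintype V] [Nontrivial V] [Fintype ι] (h : IsHamiltonDecomposition σ)
    (hc : Fintype.card ι + 1 = Fintype.card V) (u : V) : Function.Injective fun i => σ i u := by
  classical
  let f : ι → {v // v ≠ u} := fun i => ⟨σ i u, h.apply_ne i u⟩
  have hf : Function.Bijective f := by
    rw [Fintype.bijective_iff_surjective_and_card]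
    refine ⟨fun ⟨v, hv⟩ => ?_, ?_⟩
    · obtain ⟨i, hi⟩ := h.exists_apply_eq u v hv.symm
      exact ⟨i, Subtype.ext hi⟩
    · rw [Fintype.card_subtype_compl, Fintype.card_subtype_eq]
      omega
  exact fun i j hij => hf.1 (Subtype.ext hij)

theorem congr {W : Type*} (h : IsHamiltonDecomposition σ) (e : V ≃ W) :
    IsHamiltonDecomposition fun i => e.permCongr (σ i) := by
  refine ⟨fun i u v => ?_, fun u v huv => ?_⟩
  · obtain ⟨m, hm⟩ := h.sameCycle i (e.symm u) (e.symm v)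
    refine ⟨m, ?_⟩
    have : e.permCongr (σ i) ^ m = e.permCongr (σ i ^ m) :=
      (map_zpow e.permCongrHom (σ i) m).symm
    rw [this, Equiv.permCongr_apply, hm, e.apply_symm_apply]
  · obtain ⟨i, hi⟩ := h.exists_apply_eq (e.symm u) (e.symm v) (by simpa using huv)
    exact ⟨i, by simp [Equiv.permCongr_apply, hi]⟩

theorem reindex {κ : Type*} (h : IsHamiltonDecomposition σ) (e : κ ≃ ι) :
    IsHamiltonDecomposition (σ ∘ e) := by
  refine ⟨fun i => h.sameCycle (e i), fun u v huv => ?_⟩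
  obtain ⟨i, hi⟩ := h.exists_apply_eq u v huv
  exact ⟨e.symm i, by simpa using hi⟩

end IsHamiltonDecomposition

/-! ### Arc-disjoint paths from Hamilton cycles -/

namespace Digraph

variable {V : Type*}

/-- Dropping the arc of a Hamilton cycle that enters `r` leaves a Hamilton path from `r`, whatever
`S` is. -/
theorem isSteinerPath_toList [Fintype V] [DecidableEq V] [Nontrivial V] {D : Digraph V}
    {σ : Equiv.Perm V} (hσ : ∀ u v, σ.SameCycle u v) (hD : ∀ u, D.Adj u (σ u)) (S : Finset V)
    (r : V) : D.IsSteinerPath S r (σ.toList r) := by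
  have hr : r ∈ σ.support := by
    rw [Equiv.Perm.mem_support]
    intro hu
    obtain ⟨v, hv⟩ := exists_ne r
    obtain ⟨m, hm⟩ := hσ r v
    exact hv (by rw [← hm, Equiv.Perm.zpow_apply_eq_self_of_apply_eq_self hu])
  refine ⟨?_, Equiv.Perm.nodup_toList σ r, ?_, ?_⟩
  · rw [List.head?_eq_getElem?, List.getElem?_eq_some_iff]
    exact ⟨_, Equiv.Perm.toList_getElem_zero σ r hr⟩
  · rw [List.isChain_iff_getElem]
    intro i hi
    rw [Equiv.Perm.getElem_toList, Equiv.Perm.getElem_toList, pow_succ', Equiv.Perm.mul_apply]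
    exact hD _
  · exact fun v _ => Equiv.Perm.mem_toList_iff.mpr ⟨hσ r v, hr⟩

theorem apply_eq_of_mem_pathArcs_toList [Fintype V] [DecidableEq V] {σ : Equiv.Perm V} {r : V}
    {a : V × V} (ha : a ∈ pathArcs (σ.toList r)) : σ a.1 = a.2 := by
  obtain ⟨i, hi, rfl⟩ := List.mem_iff_getElem.mp (show a ∈ List.zip _ _ from ha)
  rw [List.getElem_zip, List.getElem_tail, Equiv.Perm.getElem_toList, Equiv.Perm.getElem_toList,
    pow_succ', Equiv.Perm.mul_apply]

/-- A digraph containing `#s` cycles of a Hamilton decomposition has path arc-connectivity at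
least `#s`. -/
theorem card_le_pathArcConnectivity [Fintype V] {ι : Type*} [Fintype ι] {σ : ι → Equiv.Perm V}
    (h : IsHamiltonDecomposition σ) (hc : Fintype.card ι + 1 = Fintype.card V) {D : Digraph V}
    (s : Finset ι) (hD : ∀ i ∈ s, ∀ u, D.Adj u (σ i u)) {k : ℕ} (hk : 2 ≤ k)
    (hkn : k ≤ Fintype.card V) : s.card ≤ D.pathArcConnectivity k := by
  classical
  have : Nontrivial V := Fintype.one_lt_card_iff_nontrivial.mp (by omega)
  refine le_pathArcConnectivity hk hkn fun S hS r _ => ?_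
  have hpath : ∀ i ∈ s, D.IsSteinerPath S r ((σ i).toList r) := fun i hi =>
    isSteinerPath_toList (h.sameCycle i) (hD i hi) S r
  have hdisj : ∀ i j, i ≠ j →
      Disjoint (pathArcs ((σ i).toList r)) (pathArcs ((σ j).toList r)) := by
    intro i j hij
    rw [Set.disjoint_left]
    intro a hai haj
    refine hij (h.apply_injective hc a.1 ?_)
    exact (apply_eq_of_mem_pathArcs_toList hai).trans (apply_eq_of_mem_pathArcs_toList haj).symm
  -- Equal lists would share their first arc, against disjointness.
  have hinj : Set.InjOn (fun i => (σ i).toList r) s := by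
    intro i hi j _ hij
    by_contra hne
    obtain ⟨v, l, hl, -⟩ := (hpath i hi).exists_eq_cons_cons (hS ▸ hk)
    have hmem : (r, v) ∈ pathArcs ((σ i).toList r) := by simp [hl, pathArcs]
    have hij' : (σ i).toList r = (σ j).toList r := hij
    exact Set.disjoint_left.mp (hdisj i j hne) hmem (hij' ▸ hmem)
  rw [← Finset.card_image_of_injOn hinj]
  refine card_le_arcPacking (hS ▸ hk) ?_ ?_
  · simpa using hpath
  · intro p hp q hq hpq
    obtain ⟨i, -, rfl⟩ := Finset.mem_image.mp hp
    obtain ⟨j, -, rfl⟩ := Finset.mem_image.mp hq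
    exact hdisj i j fun hij => hpq (by rw [hij])

/-- If the complete digraph on `V` has a Hamilton decomposition, then the union of `#s` of its
cycles and its complement have path arc-connectivity `#s` and `card V - 1 - #s`. -/
theorem exists_pathArcConnectivity_eq [Fintype V] {ι : Type*} [Fintype ι]
    {σ : ι → Equiv.Perm V} (h : IsHamiltonDecomposition σ)
    (hc : Fintype.card ι + 1 = Fintype.card V) (s : Finset ι) {k : ℕ} (hk : 2 ≤ k)
    (hkn : k ≤ Fintype.card V) :
    ∃ D : Digraph V, D.Loopless ∧ D.pathArcConnectivity k = s.card ∧
      D.looplessCompl.pathArcConnectivity k = Fintype.card V - 1 - s.card := by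
  classical
  have : Nontrivial V := Fintype.one_lt_card_iff_nontrivial.mp (by omega)
  let D : Digraph V := ⟨fun u v => ∃ i ∈ s, σ i u = v⟩
  have hD : D.Loopless := fun v ⟨i, _, hi⟩ => h.apply_ne i v hi
  have h1 : s.card ≤ D.pathArcConnectivity k :=
    card_le_pathArcConnectivity h hc s (D := D) (fun i hi u => ⟨i, hi, rfl⟩) hk hkn
  have h2 : sᶜ.card ≤ D.looplessCompl.pathArcConnectivity k := by
    refine card_le_pathArcConnectivity h hc (D := D.looplessCompl) sᶜ
      (fun i hi u => ⟨(h.apply_ne i u).symm, ?_⟩) hk hkn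
    rintro ⟨j, hj, hij⟩
    rw [h.apply_injective hc u hij] at hj
    exact Finset.mem_compl.mp hi hj
  -- The lower bounds `h1` and `h2` already add up to this upper bound, so both are equalities.
  have h3 := pathArcConnectivity_add_looplessCompl_le hD hk hkn
  have h4 := s.card_le_univ
  rw [Finset.card_compl] at h2
  exact ⟨D, hD, by omega, by omega⟩

end Digraph

/-! ### Adding a vertex to a Hamilton decomposition -/

namespace IsHamiltonDecomposition
/-- A sequence enumerating all of `V` is traversed cyclically by a permutation. -/
theorem exists_perm_of_sequence {V : Type*} [Fintype V] {m : ℕ} (hm : Fintype.card V = m + 1)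
    (f : ℕ → V) (hf : Set.InjOn f (Set.Iic m)) :
    ∃ σ : Equiv.Perm V, (∀ u v, σ.SameCycle u v) ∧ (∀ j < m, σ (f j) = f (j + 1)) ∧
      σ (f m) = f 0 := by
  let g : Fin (m + 1) → V := fun i => f i
  have hg : Function.Bijective g := by
    rw [Fintype.bijective_iff_injective_and_card]
    refine ⟨fun i j hij => Fin.ext (hf ?_ ?_ hij), by simp [hm]⟩ <;> simp <;> omega
  let e := Equiv.ofBijective g hg
  have he : ∀ j (hj : j < m + 1), e.symm (f j) = ⟨j, hj⟩ := fun j hj => by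
    rw [Equiv.symm_apply_eq]; rfl
  have hstep : ∀ j < m, e.permCongr (finRotate (m + 1)) (f j) = f (j + 1) := by
    intro j hj
    rw [Equiv.permCongr_apply, he j (by omega), finRotate_of_lt hj]
    rfl
  refine ⟨e.permCongr (finRotate (m + 1)), ?_, hstep, ?_⟩
  · have h0 : ∀ j ≤ m, (e.permCongr (finRotate (m + 1))).SameCycle (f 0) (f j) := by
      intro j
      induction j with
      | zero => exact fun _ => .refl _ _
      | succ j ih =>
        intro hj
        rw [← hstep j (by omega), Equiv.Perm.sameCycle_apply_right]
        exact ih (by omega)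
    intro u v
    obtain ⟨i, rfl⟩ := hg.2 u
    obtain ⟨j, rfl⟩ := hg.2 v
    exact (h0 i (by omega)).symm.trans (h0 j (by omega))
  · rw [Equiv.permCongr_apply, he m (by omega)]
    have := finRotate_last (n := m)
    rw [show (⟨m, by omega⟩ : Fin (m + 1)) = Fin.last m from rfl, this]
    rfl

/-- Inserting a new vertex into an arc of a Hamilton cycle. -/
theorem sameCycle_optionCongr_mul_swap {V : Type*} [DecidableEq V] {σ : Equiv.Perm V}
    (h : ∀ u v, σ.SameCycle u v) [Finite V] (u : V) (x y : Option V) :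
    Equiv.Perm.SameCycle (Equiv.optionCongr σ * Equiv.swap (some u) none) x y := by
  set τ : Equiv.Perm (Option V) := Equiv.optionCongr σ * Equiv.swap (some u) none with hτ
  have h1 : τ none = some (σ u) := by simp [hτ]
  have h3 : ∀ v, v ≠ u → τ (some v) = some (σ v) := fun v hv => by
    simp [hτ, Equiv.swap_apply_of_ne_of_ne (a := some u) (b := none) (x := some v)
      (by simpa) (by simp)]
  have key : ∀ m : ℕ, τ.SameCycle none (some ((σ ^ m) (σ u))) := by
    intro m
    induction m with
    | zero => exact ⟨1, by simpa using h1⟩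
    | succ m ih =>
      rw [pow_succ', Equiv.Perm.mul_apply]
      -- Once the orbit is back at `u`, its next vertex is `σ u`, which is `τ none`.
      by_cases hu : (σ ^ m) (σ u) = u
      · rw [hu]; exact ⟨1, by simpa using h1⟩
      · rw [← h3 _ hu, Equiv.Perm.sameCycle_apply_right]; exact ih
  have all : ∀ z, τ.SameCycle none z := by
    rintro (_ | z)
    · exact .refl _ _
    · obtain ⟨m, -, hm⟩ := (h (σ u) z).exists_pow_eq'
      exact hm ▸ key m
  exact (all x).symm.trans (all y)

/-- A Hamilton path with one arc in each cycle of a Hamilton decomposition allows to extend the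
decomposition to one more vertex. -/
theorem exists_option {ι V : Type*} [Fintype ι] [Fintype V] {σ : ι → Equiv.Perm V}
    (h : IsHamiltonDecomposition σ) {m : ℕ} (hm : Fintype.card V = m + 1)
    (hι : Fintype.card ι = m) (p : ℕ → V) (hp : Set.InjOn p (Set.Iic m)) (κ : ℕ → ι)
    (hκ : Set.InjOn κ (Set.Iio m)) (hpκ : ∀ j < m, σ (κ j) (p j) = p (j + 1)) :
    ∃ τ : Option ι → Equiv.Perm (Option V), IsHamiltonDecomposition τ := by
  classical
  have hp_surj : ∀ v, ∃ j ≤ m, p j = v := by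
    have hg : Function.Bijective fun i : Fin (m + 1) => p i := by
      rw [Fintype.bijective_iff_injective_and_card]
      refine ⟨fun i j hij => Fin.ext (hp ?_ ?_ hij), by simp [hm]⟩ <;> simp <;> omega
    intro v
    obtain ⟨i, hi⟩ := hg.2 v
    exact ⟨i, by omega, hi⟩
  have hκ_surj : ∀ i, ∃ j < m, κ j = i := by
    have hg : Function.Bijective fun i : Fin m => κ i := by
      rw [Fintype.bijective_iff_injective_and_card]
      refine ⟨fun i j hij => Fin.ext (hκ ?_ ?_ hij), by simp [hι]⟩ <;> simp
    intro v
    obtain ⟨i, hi⟩ := hg.2 v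
    exact ⟨i, by omega, hi⟩
  -- `c i` is the position on the path of the arc that is cut out of cycle `i`.
  choose c hcm hc using hκ_surj
  have hcκ : ∀ j < m, c (κ j) = j := fun j hj => hκ (hcm _) hj (hc _)
  let f : ℕ → Option V := fun j => if j ≤ m then some (p j) else none
  have hf : Set.InjOn f (Set.Iic (m + 1)) := by
    intro i hi j hj hij
    simp only [Set.mem_Iic] at hi hj
    by_cases h1 : i ≤ m <;> by_cases h2 : j ≤ m <;> simp only [f, h1, h2, if_true, if_false] at hij
    · exact hp h1 h2 (Option.some_injective _ hij)
    · simp at hij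
    · simp at hij
    · omega
  -- The additional cycle: the path `p`, closed through the new vertex.
  obtain ⟨ρ, hρ, hρ1, hρ2⟩ := exists_perm_of_sequence (by simp [hm]) f hf
  have hρp : ∀ j < m, ρ (some (p j)) = some (p (j + 1)) := by
    intro j hj
    simpa [f, hj.le, Nat.succ_le_of_lt hj] using hρ1 j (by omega)
  have hρm : ρ (some (p m)) = none := by simpa [f] using hρ1 m (by omega)
  have hρ0 : ρ none = some (p 0) := by simpa [f] using hρ2
  let τ : Option ι → Equiv.Perm (Option V) := fun o =>
    o.elim ρ fun i => Equiv.optionCongr (σ i) * Equiv.swap (some (p (c i))) none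
  have hτ1 : ∀ i, τ (some i) none = some (σ i (p (c i))) := fun i => by simp [τ]
  have hτ2 : ∀ i, τ (some i) (some (p (c i))) = none := fun i => by simp [τ]
  have hτ3 : ∀ i v, v ≠ p (c i) → τ (some i) (some v) = some (σ i v) := fun i v hv => by
    simp [τ, Equiv.swap_apply_of_ne_of_ne (a := some (p (c i))) (b := none) (x := some v)
      (by simpa) (by simp)]
  refine ⟨τ, ?_, ?_⟩
  · rintro (_ | i) x y
    · exact hρ x y
    · exact sameCycle_optionCongr_mul_swap (h.sameCycle i) _ x y
  · rintro (_ | u) (_ | v) huv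
    · exact absurd rfl huv
    · obtain ⟨j, hj, rfl⟩ := hp_surj v
      rcases j with _ | j
      · exact ⟨none, hρ0⟩
      · exact ⟨some (κ j), by rw [hτ1, hcκ j (by omega), hpκ j (by omega)]⟩
    · obtain ⟨j, hj, rfl⟩ := hp_surj u
      rcases hj.lt_or_eq with hj | rfl
      · refine ⟨some (κ j), ?_⟩
        have := hτ2 (κ j)
        rwa [hcκ j hj] at this
      · exact ⟨none, hρm⟩
    -- An old arc stays in its cycle unless it was cut out, in which case it lies on the path and
    -- hence on `ρ`.
    · obtain ⟨i, rfl⟩ := h.exists_apply_eq u v (by simpa using huv)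
      by_cases hu : u = p (c i)
      · refine ⟨none, ?_⟩
        have := hpκ (c i) (hcm i)
        rw [hc] at this
        rw [hu, this]
        exact hρp _ (hcm i)
      · exact ⟨some i, hτ3 i u hu⟩

end IsHamiltonDecomposition

/-! ### Odd order: translates of a zigzag cycle -/

/-- The zigzag sequence `0, 1, -1, 2, -2, …`. -/
def zigzag (k : ℕ) : ℤ :=
  if k % 2 = 0 then -(k / 2 : ℕ) else ((k + 1) / 2 : ℕ)

theorem zigzag_two_mul (e : ℕ) : zigzag (2 * e) = -e := by
  simp [zigzag]

theorem zigzag_two_mul_add_one (e : ℕ) : zigzag (2 * e + 1) = e + 1 := by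
  rw [zigzag, if_neg (by omega)]
  omega

theorem zmod_intCast_inj {N : ℕ} {a b : ℤ} (h : (a : ZMod N) = b) (h1 : |b - a| < N) : a = b := by
  rw [ZMod.intCast_eq_intCast_iff_dvd_sub] at h
  have := Int.eq_zero_of_abs_lt_dvd h h1
  omega

/-- The first `2 * t` values lie between `1 - t` and `t`, so no two of them differ by a nonzero
multiple of `2 * t`. -/
theorem injOn_zigzag (t : ℕ) :
    Set.InjOn (fun k => ((zigzag k : ℤ) : ZMod (2 * t))) (Set.Iio (2 * t)) := by
  intro i hi j hj hij
  simp only [Set.mem_Iio] at hi hj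
  have h := zmod_intCast_inj (N := 2 * t) hij (by
    rw [abs_lt, zigzag, zigzag]; split_ifs <;> push_cast <;> omega)
  rw [zigzag, zigzag] at h
  split_ifs at h <;> omega

/-- The translates of the Hamilton cycle `∞, 0, 1, -1, 2, -2, …, t` of the complete digraph on
`ZMod (2 * t)` and a point `∞`. -/
theorem exists_zigzag_cycles (t : ℕ) (ht : 0 < t) :
    ∃ σ : ZMod (2 * t) → Equiv.Perm (Option (ZMod (2 * t))),
      (∀ i u v, (σ i).SameCycle u v) ∧ (∀ i, σ i none = some i) ∧
      (∀ i, σ i (some (i + t)) = none) ∧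
      ∀ i k, k + 1 < 2 * t →
        σ i (some (i + (zigzag k : ℤ))) = some (i + (zigzag (k + 1) : ℤ)) := by
  have : NeZero (2 * t) := ⟨by omega⟩
  let f : ℕ → Option (ZMod (2 * t)) := fun j => if j = 0 then none else some (zigzag (j - 1) : ℤ)
  have hf : Set.InjOn f (Set.Iic (2 * t)) := by
    intro i hi j hj hij
    simp only [Set.mem_Iic] at hi hj
    by_cases h1 : i = 0 <;> by_cases h2 : j = 0 <;>
      simp only [f, h1, h2, if_true, if_false] at hij
    · omega
    · simp at hij
    · simp at hij
    · have := injOn_zigzag t (show i - 1 < 2 * t by omega) (show j - 1 < 2 * t by omega)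
        (Option.some_injective _ hij)
      omega
  obtain ⟨ρ, hρ, hρ1, hρ2⟩ := IsHamiltonDecomposition.exists_perm_of_sequence
    (by simp [ZMod.card]) f hf
  have h0 : ρ none = some 0 := by simpa [f, zigzag] using hρ1 0 (by omega)
  have h1 : ∀ k, k + 1 < 2 * t →
      ρ (some (zigzag k : ℤ)) = some ((zigzag (k + 1) : ℤ) : ZMod (2 * t)) := by
    intro k hk
    simpa [f] using hρ1 (k + 1) hk
  have h2 : ρ (some t) = none := by
    obtain ⟨s, rfl⟩ : ∃ s, t = s + 1 := ⟨t - 1, by omega⟩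
    have : zigzag (2 * (s + 1) - 1) = s + 1 := zigzag_two_mul_add_one s
    simpa [f, this] using hρ2
  let T : ZMod (2 * t) → Equiv.Perm (Option (ZMod (2 * t))) := fun i =>
    Equiv.optionCongr (Equiv.addLeft i)
  have hT : ∀ i a, T i (some a) = some (i + a) := fun i a => rfl
  have hTn : ∀ i, T i none = none := fun i => rfl
  have hT' : ∀ i a, (T i)⁻¹ (some (i + a)) = some a := fun i a => by
    rw [Equiv.Perm.inv_eq_iff_eq, hT]
  have hTn' : ∀ i, (T i)⁻¹ none = none := fun i => by rw [Equiv.Perm.inv_eq_iff_eq, hTn]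
  refine ⟨fun i => T i * ρ * (T i)⁻¹, fun i u v => ?_, fun i => ?_, fun i => ?_, fun i k hk => ?_⟩
  · exact Equiv.Perm.sameCycle_conj.mpr (hρ _ _)
  · simp only [Equiv.Perm.mul_apply, hTn', h0, hT, add_zero]
  · simp only [Equiv.Perm.mul_apply, hT', h2, hTn]
  · simp only [Equiv.Perm.mul_apply, hT', h1 k hk, hT]

/-- The index of the translated zigzag cycle that contains the arc from `a` to `b`. -/
def arcColor (t a b : ℕ) : ℕ :=
  (a + b) / 2 + if (a < b ∧ (b - a) % 2 = 0) ∨ (b < a ∧ (a - b) % 2 = 1) then t else 0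

/-- The arcs of cycle `i` avoiding `∞` are `i - e → i + e + 1` and `i + e + 1 → i - e - 1`. The
difference of the ends determines the type and `e`, after which either end determines `i`. -/
theorem exists_zigzag_decomposition (t : ℕ) (ht : 0 < t) :
    ∃ σ : ZMod (2 * t) → Equiv.Perm (Option (ZMod (2 * t))),
      IsHamiltonDecomposition σ ∧ (∀ i, σ i none = some i) ∧
      (∀ i, σ i (some (i + t)) = none) ∧
      ∀ a b : ℕ, a < 2 * t → b < 2 * t → a ≠ b →
        σ (arcColor t a b : ℕ) (some (a : ZMod (2 * t))) = some (b : ZMod (2 * t)) := by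
  have : NeZero (2 * t) := ⟨by omega⟩
  obtain ⟨σ, hσ, h0, h1, h2⟩ := exists_zigzag_cycles t ht
  have htt : (t : ZMod (2 * t)) + t = 0 := by
    have := ZMod.natCast_self (2 * t)
    push_cast at this
    rw [← this]; ring
  have hpos : ∀ (i a b : ZMod (2 * t)) (e : ℕ), 2 * e + 1 < 2 * t → a = i - e →
      b = i + e + 1 → σ i (some a) = some b := by
    rintro i _ _ e he rfl rfl
    have := h2 i (2 * e) he
    rw [zigzag_two_mul, zigzag_two_mul_add_one] at this
    push_cast at this
    rwa [← sub_eq_add_neg, ← add_assoc] at this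
  have hneg : ∀ (i a b : ZMod (2 * t)) (e : ℕ), 2 * e + 2 < 2 * t → a = i + e + 1 →
      b = i - e - 1 → σ i (some a) = some b := by
    rintro i _ _ e he rfl rfl
    have := h2 i (2 * e + 1) he
    rw [show 2 * e + 1 + 1 = 2 * (e + 1) by ring, zigzag_two_mul, zigzag_two_mul_add_one] at this
    push_cast at this
    rwa [← add_assoc, ← sub_eq_add_neg, ← sub_sub] at this
  have hcol : ∀ a b : ℕ, a < 2 * t → b < 2 * t → a ≠ b →
        σ (arcColor t a b : ℕ) (some (a : ZMod (2 * t))) = some (b : ZMod (2 * t)) := by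
    intro a b ha hb hab
    rcases lt_or_gt_of_ne hab with hlt | hlt
    · obtain ⟨d, rfl⟩ : ∃ d, b = a + d := ⟨b - a, by omega⟩
      rcases Nat.even_or_odd' d with ⟨e, rfl | rfl⟩
      -- Modulo `2 * t`, going up by `2 * e` is going down by `2 * g + 2`; this wrap-around shifts
      -- the index by `t`.
      · obtain ⟨g, rfl⟩ : ∃ g, t = e + g + 1 := ⟨t - e - 1, by omega⟩
        rw [show arcColor (e + g + 1) a (a + 2 * e) = a + e + (e + g + 1) by
          rw [arcColor, if_pos (by omega)]; omega]
        refine hneg _ _ _ g (by omega) ?_ ?_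
        · push_cast at htt ⊢
          linear_combination -htt
        · push_cast
          ring
      · rw [show arcColor t a (a + (2 * e + 1)) = a + e by
          rw [arcColor, if_neg (by omega)]; omega]
        refine hpos _ _ _ e (by omega) ?_ ?_
        · push_cast
          ring
        · push_cast
          ring
    · obtain ⟨d, rfl⟩ : ∃ d, a = b + d := ⟨a - b, by omega⟩
      rcases Nat.even_or_odd' d with ⟨e, rfl | rfl⟩
      · obtain ⟨e, rfl⟩ : ∃ e', e = e' + 1 := ⟨e - 1, by omega⟩
        rw [show arcColor t (b + 2 * (e + 1)) b = b + e + 1 by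
          rw [arcColor, if_neg (by omega)]; omega]
        refine hneg _ _ _ e (by omega) ?_ ?_
        · push_cast
          ring
        · push_cast
          ring
      -- Going down by `2 * e + 1` is going up by `2 * g + 1`, again with a shift by `t`.
      · obtain ⟨g, rfl⟩ : ∃ g, t = e + g + 1 := ⟨t - e - 1, by omega⟩
        rw [show arcColor (e + g + 1) (b + (2 * e + 1)) b = b + e + (e + g + 1) by
          rw [arcColor, if_pos (by omega)]; omega]
        refine hpos _ _ _ g (by omega) ?_ ?_
        · push_cast
          ring
        · push_cast at htt ⊢
          linear_combination -htt
  refine ⟨σ, ⟨hσ, ?_⟩, h0, h1, hcol⟩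
  rintro (_ | u) (_ | v) huv
  · exact absurd rfl huv
  · exact ⟨v, h0 v⟩
  · refine ⟨u - t, ?_⟩
    have := h1 (u - t)
    rwa [sub_add_cancel] at this
  · have := hcol u.val v.val u.val_lt v.val_lt fun h => huv (by rw [ZMod.val_injective _ h])
    rw [ZMod.natCast_zmod_val, ZMod.natCast_zmod_val] at this
    exact ⟨_, this⟩

/-! ### Even order: Hamilton paths with one arc in each cycle -/

theorem zmod_natCast_injOn (N : ℕ) : Set.InjOn (fun k : ℕ => (k : ZMod N)) (Set.Iio N) := by
  intro i hi j hj hij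
  exact Nat.ModEq.eq_of_lt_of_lt ((ZMod.natCast_eq_natCast_iff i j N).mp hij) hi hj

/-- A decomposition on `2 * t + 2` vertices from a Hamilton path `w` on `ZMod (2 * t)`, extended by
`∞` at its end, whose arcs have pairwise distinct colors `c`. -/
theorem exists_isHamiltonDecomposition_of_path_to_top {t : ℕ} (ht : 0 < t) (w c : ℕ → ℕ)
    (hw : ∀ j < 2 * t, w j < 2 * t) (hwi : Set.InjOn w (Set.Iio (2 * t)))
    (hc : ∀ j < 2 * t, c j < 2 * t) (hci : Set.InjOn c (Set.Iio (2 * t)))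
    (hcol : ∀ j, j + 1 < 2 * t →
      arcColor t (w j) (w (j + 1)) = c j ∨ arcColor t (w j) (w (j + 1)) = c j + 2 * t)
    (hlast : w (2 * t - 1) = c (2 * t - 1) + t ∨ c (2 * t - 1) = w (2 * t - 1) + t) :
    ∃ τ : Option (ZMod (2 * t)) → Equiv.Perm (Option (Option (ZMod (2 * t)))),
      IsHamiltonDecomposition τ := by
  have : NeZero (2 * t) := ⟨by omega⟩
  have h2t : ((2 * t : ℕ) : ZMod (2 * t)) = 0 := ZMod.natCast_self _
  obtain ⟨σ, hσ, -, h1, h2⟩ := exists_zigzag_decomposition t ht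
  refine hσ.exists_option (m := 2 * t) (by simp [ZMod.card]) (ZMod.card _)
    (fun j => if j < 2 * t then some (w j : ZMod (2 * t)) else none) ?_
    (fun j => (c j : ZMod (2 * t))) ?_ ?_
  · intro i hi j hj hij
    simp only [Set.mem_Iic] at hi hj
    by_cases hi' : i < 2 * t <;> by_cases hj' : j < 2 * t <;>
      simp only [hi', hj', if_true, if_false] at hij
    · exact hwi hi' hj' (zmod_natCast_injOn _ (hw i hi') (hw j hj') (Option.some_injective _ hij))
    · simp at hij
    · simp at hij
    · omega
  · exact fun i hi j hj hij => hci hi hj (zmod_natCast_injOn _ (hc i hi) (hc j hj) hij)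
  · intro j hj
    simp only [hj, if_true]
    by_cases hj' : j + 1 < 2 * t
    · have := h2 (w j) (w (j + 1)) (hw j hj) (hw _ hj') fun h => by
        have := hwi hj hj' h
        omega
      simp only [hj', if_true]
      rcases hcol j hj' with h | h <;> rw [h] at this
      · exact this
      · rwa [Nat.cast_add, h2t, add_zero] at this
    · obtain rfl : j = 2 * t - 1 := by omega
      simp only [hj', if_false]
      -- Cycle `i` enters `∞` from `i + t`, and `hlast` states this without reduction modulo `2 *
      -- t`.
      have := h1 (c (2 * t - 1))
      convert this using 3
      rcases hlast with h | h <;> rw [h]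
      · push_cast; ring
      · push_cast at h2t ⊢
        linear_combination -h2t

/-- A decomposition on `2 * t + 2` vertices from a Hamilton path `w` on `ZMod (2 * t)`, preceded by
`∞`, whose arcs have pairwise distinct colors `c`. -/
theorem exists_isHamiltonDecomposition_of_path_from_top {t : ℕ} (ht : 0 < t) (w c : ℕ → ℕ)
    (hw : ∀ j < 2 * t, w j < 2 * t) (hwi : Set.InjOn w (Set.Iio (2 * t)))
    (hc : ∀ j < 2 * t, c j < 2 * t) (hci : Set.InjOn c (Set.Iio (2 * t)))
    (hcol : ∀ j, j + 1 < 2 * t → arcColor t (w j) (w (j + 1)) = c (j + 1) ∨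
      arcColor t (w j) (w (j + 1)) = c (j + 1) + 2 * t)
    (hfirst : c 0 = w 0) :
    ∃ τ : Option (ZMod (2 * t)) → Equiv.Perm (Option (Option (ZMod (2 * t)))),
      IsHamiltonDecomposition τ := by
  have : NeZero (2 * t) := ⟨by omega⟩
  have h2t : ((2 * t : ℕ) : ZMod (2 * t)) = 0 := ZMod.natCast_self _
  obtain ⟨σ, hσ, h0, -, h2⟩ := exists_zigzag_decomposition t ht
  refine hσ.exists_option (m := 2 * t) (by simp [ZMod.card]) (ZMod.card _)
    (fun j => if j = 0 then none else some (w (j - 1) : ZMod (2 * t))) ?_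
    (fun j => (c j : ZMod (2 * t))) ?_ ?_
  · intro i hi j hj hij
    simp only [Set.mem_Iic] at hi hj
    by_cases hi' : i = 0 <;> by_cases hj' : j = 0 <;>
      simp only [hi', hj', if_true, if_false] at hij
    · omega
    · simp at hij
    · simp at hij
    · have hi1 : i - 1 < 2 * t := by omega
      have hj1 : j - 1 < 2 * t := by omega
      have := hwi hi1 hj1
        (zmod_natCast_injOn _ (hw _ hi1) (hw _ hj1) (Option.some_injective _ hij))
      omega
  · exact fun i hi j hj hij => hci hi hj (zmod_natCast_injOn _ (hc i hi) (hc j hj) hij)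
  · rintro (_ | j) hj
    · simp [h0, hfirst]
    · have := h2 (w j) (w (j + 1)) (hw j (by omega)) (hw _ hj) fun h => by
        have := hwi (show j < 2 * t by omega) hj h
        omega
      simp only [Nat.add_eq_zero_iff, one_ne_zero, and_false, if_false, Nat.add_sub_cancel]
      rcases hcol j hj with h | h <;> rw [h] at this
      · exact this
      · rwa [Nat.cast_add, h2t, add_zero] at this

set_option maxHeartbeats 2000000 in
/-- The Hamilton path is `t + 2, t - 1, t + 4, t + 1, …, 2 * t - 2`, then `2 * t - 1`, `2 * t - 5`,
`2 * t - 3`, then `1, 0, 3, 2, …, t - 3`, then `t - 2`, `t`, `t - 4`, and finally `∞`. -/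
theorem exists_isHamiltonDecomposition_of_even {t : ℕ} (ht : 4 ≤ t) (hte : t % 2 = 0) :
    ∃ τ : Option (ZMod (2 * t)) → Equiv.Perm (Option (Option (ZMod (2 * t)))),
      IsHamiltonDecomposition τ := by
  -- A table by ranges of `j`: `x` is the vertex at position `j`, `y` the cycle containing the arc
  -- that leaves it.
  have key : ∀ j, ∃ x y, j < 2 * t →
      ((j + 5 ≤ t ∧ j % 2 = 0) ∧ x = t + 2 + j ∧ y = j) ∨
      ((j + 5 ≤ t ∧ j % 2 = 1) ∧ x = t + j - 2 ∧ y = t + j) ∨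
      ((j + 4 = t) ∧ x = 2 * t - 2 ∧ y = 2 * t - 2) ∨
      ((j + 3 = t) ∧ x = 2 * t - 1 ∧ y = 2 * t - 3) ∨
      ((j + 2 = t) ∧ x = 2 * t - 5 ∧ y = t - 4) ∨
      ((j + 1 = t) ∧ x = 2 * t - 3 ∧ y = t - 1) ∨
      ((t ≤ j ∧ j + 5 ≤ 2 * t ∧ j % 2 = 0) ∧ x = j - t + 1 ∧ y = j) ∨
      ((t ≤ j ∧ j + 5 ≤ 2 * t ∧ j % 2 = 1) ∧ x = j - t - 1 ∧ y = j - t) ∨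
      ((j + 4 = 2 * t) ∧ x = t - 3 ∧ y = t - 3) ∨
      ((j + 3 = 2 * t) ∧ x = t - 2 ∧ y = 2 * t - 1) ∨
      ((j + 2 = 2 * t) ∧ x = t ∧ y = t - 2) ∨
      ((j + 1 = 2 * t) ∧ x = t - 4 ∧ y = 2 * t - 4) := by
    intro j
    by_cases hj : j < 2 * t
    swap
    · exact ⟨0, 0, fun h => absurd h hj⟩
    have hcases : (j + 5 ≤ t ∧ j % 2 = 0) ∨
        (j + 5 ≤ t ∧ j % 2 = 1) ∨
        (j + 4 = t) ∨
        (j + 3 = t) ∨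
        (j + 2 = t) ∨
        (j + 1 = t) ∨
        (t ≤ j ∧ j + 5 ≤ 2 * t ∧ j % 2 = 0) ∨
        (t ≤ j ∧ j + 5 ≤ 2 * t ∧ j % 2 = 1) ∨
        (j + 4 = 2 * t) ∨
        (j + 3 = 2 * t) ∨
        (j + 2 = 2 * t) ∨
        (j + 1 = 2 * t) := by
      omega
    rcases hcases with h | h | h | h | h | h | h | h | h | h | h | h
    · exact ⟨_, _, fun _ => .inl ⟨h, rfl, rfl⟩⟩
    · exact ⟨_, _, fun _ => .inr (.inl ⟨h, rfl, rfl⟩)⟩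
    · exact ⟨_, _, fun _ => .inr (.inr (.inl ⟨h, rfl, rfl⟩))⟩
    · exact ⟨_, _, fun _ => .inr (.inr (.inr (.inl ⟨h, rfl, rfl⟩)))⟩
    · exact ⟨_, _, fun _ => .inr (.inr (.inr (.inr (.inl ⟨h, rfl, rfl⟩))))⟩
    · exact ⟨_, _, fun _ => .inr (.inr (.inr (.inr (.inr (.inl ⟨h, rfl, rfl⟩)))))⟩
    · exact ⟨_, _, fun _ => .inr (.inr (.inr (.inr (.inr (.inr (.inl ⟨h, rfl, rfl⟩))))))⟩
    · exact ⟨_, _, fun _ => .inr (.inr (.inr (.inr (.inr (.inr (.inr (.inl ⟨h, rfl, rfl⟩)))))))⟩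
    · exact ⟨_, _, fun _ => .inr (.inr (.inr (.inr (.inr (.inr (.inr (.inr (.inl ⟨h, rfl, rfl⟩))))))))⟩
    · exact ⟨_, _, fun _ => .inr (.inr (.inr (.inr (.inr (.inr (.inr (.inr (.inr (.inl ⟨h, rfl, rfl⟩)))))))))⟩
    · exact ⟨_, _, fun _ => .inr (.inr (.inr (.inr (.inr (.inr (.inr (.inr (.inr (.inr (.inl ⟨h, rfl, rfl⟩))))))))))⟩
    · exact ⟨_, _, fun _ => .inr (.inr (.inr (.inr (.inr (.inr (.inr (.inr (.inr (.inr (.inr ⟨h, rfl, rfl⟩))))))))))⟩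
  choose w c key using key
  refine exists_isHamiltonDecomposition_of_path_to_top (by omega) w c ?_ ?_ ?_ ?_ ?_ ?_
  · intro j hj
    rcases key j hj with h | h | h | h | h | h | h | h | h | h | h | h <;> omega
  · intro i hi j hj hij
    rcases key i hi with h | h | h | h | h | h | h | h | h | h | h | h <;>
      rcases key j hj with h' | h' | h' | h' | h' | h' | h' | h' | h' | h' | h' | h' <;> omega
  · intro j hj
    rcases key j hj with h | h | h | h | h | h | h | h | h | h | h | h <;> omega
  · intro i hi j hj hij
    rcases key i hi with h | h | h | h | h | h | h | h | h | h | h | h <;>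
      rcases key j hj with h' | h' | h' | h' | h' | h' | h' | h' | h' | h' | h' | h' <;> omega
  · intro j hj
    rcases key j (by omega) with h | h | h | h | h | h | h | h | h | h | h | h <;>
      -- Row pairs that cannot hold at `j` and `j + 1` are contradictory; the others need the color
      -- computed.
      rcases key (j + 1) hj with h' | h' | h' | h' | h' | h' | h' | h' | h' | h' | h' | h' <;>
      first
      | omega
      | rw [arcColor, h.2.1, h'.2.1]
        split_ifs <;> omega
  · have := key (2 * t - 1) (by omega)
    omega

set_option maxHeartbeats 1000000 in
/-- The Hamilton path is `∞`, then `t - 3, t + 2, t - 1, t + 4, …, 2 * t - 1`, then `2 * t - 2`,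
`2 * t - 4`, then `1, 0, 3, 2, …, t - 2`, and finally `t`. -/
theorem exists_isHamiltonDecomposition_of_odd {t : ℕ} (ht : 3 ≤ t) (hto : t % 2 = 1) :
    ∃ τ : Option (ZMod (2 * t)) → Equiv.Perm (Option (Option (ZMod (2 * t)))),
      IsHamiltonDecomposition τ := by
  -- Here `y` is the cycle containing the arc that enters `x`, since the path starts at `∞`.
  have key : ∀ j, ∃ x y, j < 2 * t →
      ((j = 0) ∧ x = t - 3 ∧ y = t - 3) ∨
      ((0 < j ∧ j + 2 ≤ t ∧ j % 2 = 0) ∧ x = t + j - 3 ∧ y = j - 2) ∨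
      ((j + 2 ≤ t ∧ j % 2 = 1) ∧ x = t + j + 1 ∧ y = t + j - 2) ∨
      ((j + 1 = t) ∧ x = 2 * t - 2 ∧ y = t - 2) ∨
      ((j = t) ∧ x = 2 * t - 4 ∧ y = 2 * t - 3) ∨
      ((j = t + 1) ∧ x = 1 ∧ y = 2 * t - 2) ∨
      ((t + 2 ≤ j ∧ j + 2 ≤ 2 * t ∧ j % 2 = 0) ∧ x = j - t ∧ y = j - t - 2) ∨
      ((t + 2 ≤ j ∧ j + 2 ≤ 2 * t ∧ j % 2 = 1) ∧ x = j - t - 2 ∧ y = j - 2) ∨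
      ((j + 1 = 2 * t) ∧ x = t ∧ y = 2 * t - 1) := by
    intro j
    by_cases hj : j < 2 * t
    swap
    · exact ⟨0, 0, fun h => absurd h hj⟩
    have hcases : (j = 0) ∨
        (0 < j ∧ j + 2 ≤ t ∧ j % 2 = 0) ∨
        (j + 2 ≤ t ∧ j % 2 = 1) ∨
        (j + 1 = t) ∨
        (j = t) ∨
        (j = t + 1) ∨
        (t + 2 ≤ j ∧ j + 2 ≤ 2 * t ∧ j % 2 = 0) ∨
        (t + 2 ≤ j ∧ j + 2 ≤ 2 * t ∧ j % 2 = 1) ∨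
        (j + 1 = 2 * t) := by
      omega
    rcases hcases with h | h | h | h | h | h | h | h | h
    · exact ⟨_, _, fun _ => .inl ⟨h, rfl, rfl⟩⟩
    · exact ⟨_, _, fun _ => .inr (.inl ⟨h, rfl, rfl⟩)⟩
    · exact ⟨_, _, fun _ => .inr (.inr (.inl ⟨h, rfl, rfl⟩))⟩
    · exact ⟨_, _, fun _ => .inr (.inr (.inr (.inl ⟨h, rfl, rfl⟩)))⟩
    · exact ⟨_, _, fun _ => .inr (.inr (.inr (.inr (.inl ⟨h, rfl, rfl⟩))))⟩
    · exact ⟨_, _, fun _ => .inr (.inr (.inr (.inr (.inr (.inl ⟨h, rfl, rfl⟩)))))⟩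
    · exact ⟨_, _, fun _ => .inr (.inr (.inr (.inr (.inr (.inr (.inl ⟨h, rfl, rfl⟩))))))⟩
    · exact ⟨_, _, fun _ => .inr (.inr (.inr (.inr (.inr (.inr (.inr (.inl ⟨h, rfl, rfl⟩)))))))⟩
    · exact ⟨_, _, fun _ => .inr (.inr (.inr (.inr (.inr (.inr (.inr (.inr ⟨h, rfl, rfl⟩)))))))⟩
  choose w c key using key
  refine exists_isHamiltonDecomposition_of_path_from_top (by omega) w c ?_ ?_ ?_ ?_ ?_ ?_
  · intro j hj
    rcases key j hj with h | h | h | h | h | h | h | h | h <;> omega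
  · intro i hi j hj hij
    rcases key i hi with h | h | h | h | h | h | h | h | h <;>
      rcases key j hj with h' | h' | h' | h' | h' | h' | h' | h' | h' <;> omega
  · intro j hj
    rcases key j hj with h | h | h | h | h | h | h | h | h <;> omega
  · intro i hi j hj hij
    rcases key i hi with h | h | h | h | h | h | h | h | h <;>
      rcases key j hj with h' | h' | h' | h' | h' | h' | h' | h' | h' <;> omega
  · intro j hj
    rcases key j (by omega) with h | h | h | h | h | h | h | h | h <;>
      rcases key (j + 1) hj with h' | h' | h' | h' | h' | h' | h' | h' | h' <;>
      first
      | omega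
      | rw [arcColor, h.2.1, h'.2.1]
        split_ifs <;> omega
  · have := key 0 (by omega)
    omega

/-! ### Existence of the decomposition and the final bounds -/

/-- The complete digraph on at least seven vertices has a Hamilton decomposition. -/
theorem exists_isHamiltonDecomposition {V : Type*} [Fintype V] {m : ℕ} (hm : 6 ≤ m)
    (hV : Fintype.card V = m + 1) :
    ∃ σ : Fin m → Equiv.Perm V, IsHamiltonDecomposition σ := by
  have transport : ∀ {ι W : Type} [Fintype ι] [Fintype W] {τ : ι → Equiv.Perm W},
      IsHamiltonDecomposition τ → Fintype.card ι = m → Fintype.card W = m + 1 →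
      ∃ σ : Fin m → Equiv.Perm V, IsHamiltonDecomposition σ := by
    intro ι W _ _ τ hτ hι hW
    exact ⟨_, (hτ.congr (Fintype.equivOfCardEq (hW.trans hV.symm))).reindex
      (Fintype.equivFinOfCardEq hι).symm⟩
  rcases Nat.even_or_odd' m with ⟨t, rfl | rfl⟩
  · have : NeZero (2 * t) := ⟨by omega⟩
    obtain ⟨σ, hσ, -⟩ := exists_zigzag_decomposition t (by omega)
    exact transport hσ (ZMod.card _) (by simp [ZMod.card])
  · have : NeZero (2 * t) := ⟨by omega⟩
    obtain ⟨τ, hτ⟩ : ∃ τ : Option (ZMod (2 * t)) → Equiv.Perm (Option (Option (ZMod (2 * t)))),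
        IsHamiltonDecomposition τ := by
      -- Here `2 * t + 1 ≥ 6` gives `t ≥ 3`, hence `t ≥ 4` when `t` is even.
      rcases Nat.mod_two_eq_zero_or_one t with h | h
      · exact exists_isHamiltonDecomposition_of_even (by omega) h
      · exact exists_isHamiltonDecomposition_of_odd (by omega) h
    exact transport hτ (by simp [ZMod.card]) (by simp [ZMod.card])

/-- AM-GM: `4ab ≤ (a + b)²`. -/
theorem mul_le_floor_sq_div_two {n a b : ℕ} (hn : 1 ≤ n) (h : a + b ≤ n - 1) :
    a * b ≤ ⌊(((n : ℚ) - 1) / 2) ^ 2⌋₊ := by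
  apply Nat.le_floor
  have h' : (a : ℚ) + b ≤ n - 1 := by
    have : a + b + 1 ≤ n := by omega
    have : ((a + b + 1 : ℕ) : ℚ) ≤ n := by exact_mod_cast this
    push_cast at this
    linarith
  have ha : (0 : ℚ) ≤ a := a.cast_nonneg
  have hb : (0 : ℚ) ≤ b := b.cast_nonneg
  push_cast
  nlinarith [sq_nonneg ((a : ℚ) - b)]

theorem half_mul_half_eq_floor {n : ℕ} (hn : 1 ≤ n) :
    (n - 1) / 2 * (n - 1 - (n - 1) / 2) = ⌊(((n : ℚ) - 1) / 2) ^ 2⌋₊ := by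
  obtain ⟨m, rfl⟩ : ∃ m, n = m + 1 := ⟨n - 1, by omega⟩
  symm
  rw [Nat.floor_eq_iff (sq_nonneg _)]
  rcases Nat.even_or_odd' m with ⟨s, rfl | rfl⟩
  · rw [show (2 * s + 1 - 1) / 2 = s by omega, show 2 * s + 1 - 1 - s = s by omega]
    push_cast
    constructor <;> nlinarith
  · rw [show (2 * s + 1 + 1 - 1) / 2 = s by omega, show 2 * s + 1 + 1 - 1 - s = s + 1 by omega]
    push_cast
    constructor <;> nlinarith

theorem theorem3p4 {V : Type*} [Fintype V] (n k : ℕ) (hV : Fintype.card V = n) (hn : 7 ≤ n)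
    (hk : 2 ≤ k) (hkn : k ≤ n) :
    -- the bounds on the sum and on the product
    (∀ D : Digraph V, D.Loopless →
      (0 ≤ D.pathArcConnectivity k + D.looplessCompl.pathArcConnectivity k ∧
        D.pathArcConnectivity k + D.looplessCompl.pathArcConnectivity k ≤ n - 1) ∧
      (0 ≤ D.pathArcConnectivity k * D.looplessCompl.pathArcConnectivity k ∧
        D.pathArcConnectivity k * D.looplessCompl.pathArcConnectivity k ≤
          ⌊(((n : ℚ) - 1) / 2) ^ 2⌋₊)) ∧
    -- both bounds on the sum are attained
    (∃ D : Digraph V, D.Loopless ∧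
      D.pathArcConnectivity k + D.looplessCompl.pathArcConnectivity k = 0) ∧
    (∃ D : Digraph V, D.Loopless ∧
      D.pathArcConnectivity k + D.looplessCompl.pathArcConnectivity k = n - 1) ∧
    -- both bounds on the product are attained
    (∃ D : Digraph V, D.Loopless ∧
      D.pathArcConnectivity k * D.looplessCompl.pathArcConnectivity k = 0) ∧
    (∃ D : Digraph V, D.Loopless ∧
      D.pathArcConnectivity k * D.looplessCompl.pathArcConnectivity k =
        ⌊(((n : ℚ) - 1) / 2) ^ 2⌋₊) := by
  subst hV
  have h0 := Digraph.exists_pathArcConnectivity_add_looplessCompl_eq_zero hk hkn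
  -- One balanced split of the cycles attains both maxima.
  have hmax : ∃ D : Digraph V, D.Loopless ∧
      D.pathArcConnectivity k = (Fintype.card V - 1) / 2 ∧
      D.looplessCompl.pathArcConnectivity k =
        Fintype.card V - 1 - (Fintype.card V - 1) / 2 := by
    obtain ⟨σ, hσ⟩ := exists_isHamiltonDecomposition (V := V) (m := Fintype.card V - 1)
      (by omega) (by omega)
    obtain ⟨s, -, hs⟩ := Finset.exists_subset_card_eq
      (s := (Finset.univ : Finset (Fin (Fintype.card V - 1))))
      (n := (Fintype.card V - 1) / 2) (by rw [Finset.card_univ, Fintype.card_fin]; omega)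
    rw [← hs]
    exact Digraph.exists_pathArcConnectivity_eq hσ (by rw [Fintype.card_fin]; omega) s hk hkn
  refine ⟨fun D hD => ?_, h0, ?_, ?_, ?_⟩
  · have h := Digraph.pathArcConnectivity_add_looplessCompl_le hD hk hkn
    exact ⟨⟨Nat.zero_le _, h⟩, Nat.zero_le _, mul_le_floor_sq_div_two (by omega) h⟩
  · obtain ⟨D, hD, h1, h2⟩ := hmax
    exact ⟨D, hD, by omega⟩
  · obtain ⟨D, hD, h⟩ := h0
    exact ⟨D, hD, by rw [(Nat.add_eq_zero_iff.mp h).1, zero_mul]⟩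
  · obtain ⟨D, hD, h1, h2⟩ := hmax
    exact ⟨D, hD, by rw [h1, h2, half_mul_half_eq_floor (by omega)]⟩
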